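/- **Theorem.** Every plane quadrangulation admits a strong labeling. Here a *plane quadrangulation* is a finite simple plane graph $Q$ with $n\ge 4$ vertices that is maximal bipartite, i.e. $Q$ is bipartite and no bipartite plane graph on the same vertex set has more edges. Fix a proper colouring of the vertices of $Q$ with the colours black and white. Then exactly two black vertices lie on the outer face of $Q$; name them $s_0$ and $s_1$ in any order. The claim is that there is a map from the set of angles of $Q$ (the corners between two consecutive edges around a vertex) to $\{0,1\}$ such that: 1. (Special vertices) all angles at $s_0$ are labeled $0$ and all angles at $s_1$ are labeled $1$; 2. (Vertex rule) at each vertex $v\notin\{s_0,s_1\}$ the labels in cyclic order around $v$ form one non-empty interval of $0$s and one non-empty interval of $1$s; 3. (Edge rule) for each edge, the two labels incident to it at one endpoint coincide, and the two labels incident to it at the other endpoint differ; 4. (Strong face rule) each face, including the outer face, has exactly four angles, whose labels read $0011$ cyclically; moreover, the labels of the outer face, read in clockwise order around the outer cycle starting at $s_0$, are $0,0,1,1$. -/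

import Mathlib

/-- A finite connected simple plane graph with at least one edge, up to orientation preserving
homeomorphism of the plane: a connected simple graph on the vertex set `V` with a rotation system
of genus zero and a distinguished outer face.

The dart `d` is the edge `d.edge` directed from `d.fst` to `d.snd`, and `rot d` is the next dart
after `d` in counterclockwise order around `d.fst`.  The face on the left of `d` is left of the
darts `d`, `rot⁻¹ d.symm`, ... in this order, so the faces are the cycles of `rot⁻¹ ∘ symm`. -/
structure PlaneGraph (V : Type*) [Fintype V] where
  /-- the underlying graph -/
  graph : SimpleGraph V
  connected : graph.Connected
  /-- the counterclockwise successor of a dart around its start vertex -/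
  rot : Equiv.Perm graph.Dart
  /-- around every vertex, `rot` is one cyclic order of the darts that start there -/
  rot_sameCycle : ∀ d e : graph.Dart, rot.SameCycle d e ↔ d.fst = e.fst
  /-- Euler's formula: the embedding is in the sphere -/
  euler : (Fintype.card V : ℤ) - (graph.edgeSet.ncard : ℤ) +
    (Nat.card (Quotient (Equiv.Perm.SameCycle.setoid
      ((SimpleGraph.Dart.symm_involutive (G := graph)).toPerm.trans rot.symm))) : ℤ) = 2
  /-- the outer (unbounded) face -/
  outerFace : Quotient (Equiv.Perm.SameCycle.setoid
    ((SimpleGraph.Dart.symm_involutive (G := graph)).toPerm.trans rot.symm))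

namespace PlaneGraph

variable {V : Type*} [Fintype V] (Q : PlaneGraph V)

/-- The angles (corners) of a plane graph.  The dart `d` stands for the angle at the vertex `d.fst`
between the dart `d` and the counterclockwise next dart `Q.rot d`; it lies on the left of `d`. -/
abbrev Angle : Type _ := Q.graph.Dart

/-- The next angle of the same face, walking along the boundary with the face on the left: inner
faces are read counterclockwise, and the outer face is read clockwise. -/
def next : Equiv.Perm Q.Angle :=
  (SimpleGraph.Dart.symm_involutive (G := Q.graph)).toPerm.trans Q.rot.symm

theorem next_apply (d : Q.Angle) : Q.next d = Q.rot⁻¹ d.symm := rfl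

/-- The faces, including the outer face. -/
abbrev Face : Type _ := Quotient (Equiv.Perm.SameCycle.setoid Q.next)

/-- The face that contains the angle `a`. -/
def face (a : Q.Angle) : Q.Face := Quotient.mk _ a

/-- The set of the vertices on the outer face. -/
def outerVertices : Set V := {v | ∃ a : Q.Angle, a.fst = v ∧ Q.face a = Q.outerFace}

/-- A quadrangulation is a maximal bipartite plane graph: no bipartite plane graph on the same
vertex set has more edges.  (Joining two components of a disconnected bipartite plane graph by an
edge gives a bipartite plane graph again, so only connected competitors matter.) -/
def IsQuadrangulation : Prop :=
  Q.graph.IsBipartite ∧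
    ∀ H : PlaneGraph V, H.graph.IsBipartite → H.graph.edgeSet.ncard ≤ Q.graph.edgeSet.ncard

/-- Strong labelings of a plane graph with colour class `black`, for the special vertices
`s₀` and `s₁`. -/
structure IsStrongLabeling (black : Set V) (s₀ s₁ : V) (lab : Q.Angle → Fin 2) : Prop where
  /-- `s₀` and `s₁` are the two black vertices on the outer face -/
  special_ne : s₀ ≠ s₁
  special : black ∩ Q.outerVertices = {s₀, s₁}
  /-- all angles at `s₀` are labeled `0` -/
  special_zero : ∀ a : Q.Angle, a.fst = s₀ → lab a = 0
  /-- all angles at `s₁` are labeled `1` -/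
  special_one : ∀ a : Q.Angle, a.fst = s₁ → lab a = 1
  /-- vertex rule: the angles around `v`, read counterclockwise from a suitable angle `a`, are
  labeled by `k` zeros followed by `deg v - k` ones, with `0 < k < deg v` -/
  vertex_rule : ∀ v : V, v ≠ s₀ → v ≠ s₁ →
    ∃ a : Q.Angle, a.fst = v ∧ ∃ k : ℕ, 0 < k ∧ k < (Q.graph.neighborSet v).ncard ∧
      (∀ i < k, lab ((Q.rot ^ i) a) = 0) ∧
      (∀ i, k ≤ i → i < (Q.graph.neighborSet v).ncard → lab ((Q.rot ^ i) a) = 1)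
  /-- edge rule: the two labels incident to an edge coincide at one endpoint and differ at the
  other; the angles at `d.fst` incident to the edge are those to the left and right of `d` -/
  edge_rule : ∀ d : Q.graph.Dart,
    Xor (lab d = lab (Q.rot⁻¹ d)) (lab d.symm = lab (Q.rot⁻¹ d.symm))
  /-- strong face rule: every face has four angles, labeled `0011` cyclically -/
  face_rule : ∀ f : Q.Face, ∃ a : Q.Angle, Q.face a = f ∧ (Q.next ^ 4) a = a ∧
    lab a = 0 ∧ lab (Q.next a) = 0 ∧ lab ((Q.next ^ 2) a) = 1 ∧ lab ((Q.next ^ 3) a) = 1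
  /-- the labels of the outer face, read clockwise from `s₀`, are `0011` -/
  outer_face_rule : ∀ a : Q.Angle, Q.face a = Q.outerFace → a.fst = s₀ →
    lab a = 0 ∧ lab (Q.next a) = 0 ∧ lab ((Q.next ^ 2) a) = 1 ∧ lab ((Q.next ^ 3) a) = 1

end PlaneGraph

/-! Join the two black corners of every face by a diagonal. The black vertices with these diagonals
form a graph that stays connected when any one vertex is deleted (`linked_of_mem`), so it has an
st-numbering from `s₀` to `s₁` (`SimpleGraph.exists_st_numbering`, built by inserting ears). In
every face, label the black corner with the smaller number 0 and the other black corner 1, and let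
each white corner copy the label before it. The edge and face rules become local checks, and the
special vertices are the minimum and the maximum of the numbering.

For the vertex rule, each ordinary vertex sees both labels: a black one has a lower and a higher
diagonal neighbor, a white one has a highest and a lowest neighbor. Hence at least two label changes
occur around it. By the edge rule there is one change per edge, 2n - 4 in all, for n - 2 ordinary
vertices, so each has exactly two (`vertex_rule_of_edge_rule`).

This needs 2n - 4 edges and quadrangular faces (`IsQuadrangulation.ncard_edgeSet_and_next`). Facial
walks have length at least 4, so Euler's formula bounds the edges by 2n - 4. The competitor
`K_{2,n-2}` attains this, and equality makes every face a quadrangle. -/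

open scoped List

/-! ### Ears and st-numberings. -/

/-- In a graph that stays connected after deleting any vertex, a proper set `S` with at least two
vertices has an ear: a path outside `S` whose ends have distinct neighbors in `S`. -/
theorem SimpleGraph.exists_ear {α : Type*} (G : SimpleGraph α)
    (hG : ∀ v a b : α, a ≠ v → b ≠ v →
      Relation.ReflTransGen (fun x y => G.Adj x y ∧ y ≠ v) a b)
    {S : Set α} {s t u : α} (hs : s ∈ S) (ht : t ∈ S) (hst : s ≠ t) (hu : u ∉ S) :
    ∃ x ∈ S, ∃ y ∈ S, x ≠ y ∧ ∃ P : List α, P ≠ [] ∧ P.Nodup ∧ (∀ p ∈ P, p ∉ S) ∧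
      (x :: P ++ [y]).IsChain G.Adj := by
  let H := G.induce Sᶜ
  let C : Set α := {p | ∃ hp : p ∉ S, H.Reachable ⟨u, hu⟩ ⟨p, hp⟩}
  have huC : u ∈ C := ⟨hu, SimpleGraph.Reachable.refl _⟩
  -- `C` is the component of `u` outside `S`. After deleting `x`, a path from `u` to `z` still
  -- exists, and it can leave `C` only into `S`.
  have step : ∀ x, x ∉ C → ∀ z ∈ S, z ≠ x → ∃ p ∈ C, ∃ y ∈ S, y ≠ x ∧ G.Adj p y := by
    intro x hx z hz hzx
    by_contra! hcon
    have key : ∀ b, Relation.ReflTransGen (fun a y => G.Adj a y ∧ y ≠ x) u b → b ∈ C := by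
      intro b hb
      induction hb with
      | refl => exact huC
      | tail _ hbc ih =>
        obtain ⟨hbS, hr⟩ := ih
        have hcS := fun hc => hcon _ ⟨hbS, hr⟩ _ hc hbc.2 hbc.1
        refine ⟨hcS, hr.trans (SimpleGraph.Adj.reachable ?_)⟩
        exact hbc.1
    obtain ⟨hzS, -⟩ := key z (hG x u z (fun h => hx (h ▸ huC)) hzx)
    exact hzS hz
  -- The first call only supplies some attachment `x`; the second, with `x` itself deleted, supplies
  -- a different one.
  obtain ⟨p, hp, x, hxS, -, hpx⟩ := step s (fun h => h.1 hs) t ht hst.symm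
  obtain ⟨z, hz, hzx⟩ : ∃ z ∈ S, z ≠ x := by
    by_cases h : s = x
    · exact ⟨t, ht, fun h' => hst (h.trans h'.symm)⟩
    · exact ⟨s, hs, h⟩
  obtain ⟨q, hq, y, hyS, hyx, hqy⟩ := step x (fun h => h.1 hxS) z hz hzx
  obtain ⟨hpS, hup⟩ := hp
  obtain ⟨hqS, huq⟩ := hq
  obtain ⟨w, hw⟩ := (hup.symm.trans huq).exists_isPath
  refine ⟨x, hxS, y, hyS, hyx.symm, w.support.map Subtype.val,
    mt List.map_eq_nil_iff.1 w.support_ne_nil,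
    hw.support_nodup.map Subtype.val_injective, ?_, ?_⟩
  · intro a ha
    obtain ⟨b, -, rfl⟩ := List.mem_map.1 ha
    exact b.2
  · have h1 : (w.support.map Subtype.val).IsChain G.Adj := by
      rw [List.isChain_map]
      exact w.isChain_adj_support.imp (fun a b h => h)
    have hhead : (w.support.map Subtype.val).head? = some p := by
      rw [List.head?_map, List.head?_eq_some_head w.support_ne_nil, w.head_support]; rfl
    have hlast : (w.support.map Subtype.val).getLast? = some q := by
      rw [List.getLast?_map, List.getLast?_eq_some_getLast w.support_ne_nil,
        w.getLast_support]; rfl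
    rw [List.isChain_append]
    refine ⟨?_, by simp, ?_⟩
    · rw [List.isChain_cons]
      refine ⟨fun a ha => ?_, h1⟩
      rw [hhead] at ha
      cases ha
      exact hpx.symm
    · intro a ha b hb
      rw [List.getLast?_cons, hlast] at ha
      simp at ha hb
      subst ha hb
      exact hqy

/-- In a chain, every interior entry has a related predecessor and a related successor. -/
theorem List.IsChain.exists_sublist_triple {α : Type*} {r : α → α → Prop} {x y : α} {P : List α}
    (h : (x :: P ++ [y]).IsChain r) {p : α} (hp : p ∈ P) :
    ∃ a b, r a p ∧ r p b ∧ [a, p, b] <+ x :: P ++ [y] := by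
  obtain ⟨P₁, P₂, rfl⟩ := List.append_of_mem hp
  obtain ⟨M, a, hM⟩ : ∃ M a, x :: P₁ = M ++ [a] :=
    ⟨_, _, (List.dropLast_append_getLast (List.cons_ne_nil x P₁)).symm⟩
  obtain ⟨b, N, hN⟩ : ∃ b N, P₂ ++ [y] = b :: N := List.exists_cons_of_ne_nil (by simp)
  have e : x :: (P₁ ++ p :: P₂) ++ [y] = M ++ ([a, p, b] ++ N) := by
    have : x :: (P₁ ++ p :: P₂) ++ [y] = (x :: P₁) ++ p :: (P₂ ++ [y]) := by simp
    rw [this, hM, hN]; simp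
  rw [e] at h ⊢
  have h3 : [a, p, b].IsChain r := h.right_of_append.left_of_append
  simp only [List.isChain_cons_cons] at h3
  exact ⟨a, b, h3.1, h3.2.1,
    (List.sublist_append_left _ _).trans (List.sublist_append_right _ _)⟩

/-- Existence of `st`-orderings. -/
theorem SimpleGraph.exists_st_list {α : Type*} [Finite α] (G : SimpleGraph α)
    (hG : ∀ v a b : α, a ≠ v → b ≠ v →
      Relation.ReflTransGen (fun x y => G.Adj x y ∧ y ≠ v) a b)
    {s t : α} (hst : s ≠ t) :
    ∃ L : List α, L.Nodup ∧ (∀ v, v ∈ L) ∧ (∃ M, L = s :: M ++ [t]) ∧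
      ∀ v, v ≠ s → v ≠ t → ∃ a b, G.Adj a v ∧ G.Adj v b ∧ [a, v, b] <+ L := by
  classical
  have := Fintype.ofFinite α
  let good : List α → Prop := fun L => L.Nodup ∧ (∃ M, L = s :: M ++ [t]) ∧
    ∀ v ∈ L, v ≠ s → v ≠ t → ∃ a b, G.Adj a v ∧ G.Adj v b ∧ [a, v, b] <+ L
  have extend : ∀ L, good L → (∃ u, u ∉ L) → ∃ L', good L' ∧ L.length < L'.length := by
    rintro L ⟨hnd, ⟨M, hM⟩, htri⟩ ⟨u, hu⟩
    obtain ⟨x, hx, y, hy, hxy, P, hP, hPnd, hPL, hch⟩ :=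
      G.exists_ear hG (S := {v | v ∈ L}) (s := s) (t := t) (by simp [hM]) (by simp [hM]) hst hu
    -- The ear is inserted directly after its earlier end `x`. The old list stays a sublist, so the
    -- old triples survive. If `y` comes first, the ear is reversed.
    have main : ∀ A B x y P, L = A ++ x :: B → y ∈ B → P ≠ [] → P.Nodup → (∀ p ∈ P, p ∉ L) →
        (x :: P ++ [y]).IsChain G.Adj → ∃ L', good L' ∧ L.length < L'.length := by
      clear hch hPL hPnd hP hxy hy hx P x y
      intro A B x y P hL hy hP hPnd hPL hch
      have hsub : L <+ A ++ x :: P ++ B := by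
        rw [hL]
        simp
      have hsub2 : x :: P ++ [y] <+ A ++ x :: P ++ B := by
        rw [List.append_assoc]
        exact ((List.Sublist.refl _).append (List.singleton_sublist.2 hy)).trans
          (List.sublist_append_right _ _)
      have hperm : (A ++ x :: P ++ B).Perm (P ++ L) := by
        rw [hL]
        have h1 : A ++ x :: P ++ B = (A ++ [x]) ++ (P ++ B) := by simp
        have h2 : P ++ (A ++ x :: B) = P ++ ((A ++ [x]) ++ B) := by simp
        rw [h1, h2, ← List.append_assoc, ← List.append_assoc P]
        exact List.perm_append_comm.append_right _
      refine ⟨A ++ x :: P ++ B, ⟨?_, ?_, ?_⟩, ?_⟩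
      · rw [hperm.nodup_iff]
        exact hPnd.append hnd (fun p hp hpL => hPL p hp hpL)
      · obtain ⟨B', hB'⟩ : ∃ B', B = B' ++ [t] := by
          obtain ⟨B', b, rfl⟩ : ∃ B' b, B = B' ++ [b] :=
            ⟨_, _, (List.dropLast_append_getLast (List.ne_nil_of_mem hy)).symm⟩
          have := congrArg List.getLast? (hL.symm.trans hM)
          rw [← List.cons_append, ← List.append_assoc, List.getLast?_concat,
            List.getLast?_concat] at this
          cases this
          exact ⟨B', rfl⟩
        subst hB'
        cases A with
        | nil =>
          have : x = s := by
            have := hL.symm.trans hM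
            simp at this
            exact this.1
          subst this
          exact ⟨P ++ B', by simp⟩
        | cons a A =>
          have : a = s := by
            have := hL.symm.trans hM
            simp at this
            exact this.1
          subst this
          exact ⟨A ++ x :: P ++ B', by simp⟩
      · intro v hv hvs hvt
        rw [hperm.mem_iff, List.mem_append] at hv
        rcases hv with hv | hv
        · obtain ⟨a, b, h1, h2, h3⟩ := hch.exists_sublist_triple hv
          exact ⟨a, b, h1, h2, h3.trans hsub2⟩
        · obtain ⟨a, b, h1, h2, h3⟩ := htri v hv hvs hvt
          exact ⟨a, b, h1, h2, h3.trans hsub⟩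
      · rw [hperm.length_eq, List.length_append]
        have := List.length_pos_of_ne_nil hP
        omega
    obtain ⟨A, B, hAB⟩ := List.append_of_mem hx
    have hy' : y ∈ A ∨ y ∈ B := by
      have : y ∈ A ++ x :: B := hAB ▸ hy
      simp only [List.mem_append, List.mem_cons] at this
      rcases this with h | h | h
      · exact Or.inl h
      · exact absurd h.symm hxy
      · exact Or.inr h
    rcases hy' with hy' | hy'
    · obtain ⟨A₁, A₂, rfl⟩ := List.append_of_mem hy'
      refine main A₁ (A₂ ++ x :: B) y x P.reverse (by simp [hAB]) (by simp) (by simpa)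
        (by simpa) (by simpa using hPL) ?_
      have : (x :: P ++ [y]).reverse.IsChain G.Adj :=
        List.isChain_reverse.2 (hch.imp fun a b h => h.symm)
      simpa using this
    · exact main A B x y P hAB hy' hP hPnd hPL hch
  by_contra! hcon
  -- Extension from `[s, t]` would never stop, but a list without repetition has bounded length.
  have long : ∀ k : ℕ, ∃ L, good L ∧ k ≤ L.length := by
    intro k
    induction k with
    | zero =>
      refine ⟨[s, t], ⟨by simpa using hst, ⟨[], rfl⟩, ?_⟩, Nat.zero_le _⟩
      intro v hv h1 h2
      simp [h1, h2] at hv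
    | succ k ih =>
      obtain ⟨L, hL, hk⟩ := ih
      have hne : ∃ u, u ∉ L := by
        by_contra! hall
        obtain ⟨v, h1, h2, h3⟩ := hcon L hL.1 hall hL.2.1
        obtain ⟨a, b, h4, h5, h6⟩ := hL.2.2 v (hall v) h1 h2
        exact h3 a b h4 h5 h6
      obtain ⟨L', hL', hlt⟩ := extend L hL hne
      exact ⟨L', hL', by omega⟩
  obtain ⟨L, hL, hk⟩ := long (Fintype.card α + 1)
  have := hL.1.length_le_card
  omega

/-- Existence of `st`-numberings. -/
theorem SimpleGraph.exists_st_numbering {α : Type*} [Finite α] (G : SimpleGraph α)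
    (hG : ∀ v a b : α, a ≠ v → b ≠ v →
      Relation.ReflTransGen (fun x y => G.Adj x y ∧ y ≠ v) a b)
    {s t : α} (hst : s ≠ t) :
    ∃ h : α → ℕ, h.Injective ∧ (∀ v, v ≠ s → h s < h v) ∧ (∀ v, v ≠ t → h v < h t) ∧
      ∀ v, v ≠ s → v ≠ t → (∃ a, G.Adj v a ∧ h a < h v) ∧ ∃ b, G.Adj v b ∧ h v < h b := by
  classical
  obtain ⟨L, hnd, hall, ⟨M, hM⟩, htri⟩ := G.exists_st_list hG hst
  have hpw : L.Pairwise (fun a b => L.idxOf a < L.idxOf b) := by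
    rw [List.pairwise_iff_getElem]
    intro i j hi hj hij
    rwa [hnd.idxOf_getElem, hnd.idxOf_getElem]
  refine ⟨fun v => L.idxOf v, fun a b hab => (List.idxOf_inj (hall a)).1 hab, ?_, ?_, ?_⟩
  · intro v hv
    have hv' : v ∈ M ++ [t] := by
      have := hall v
      rw [hM, List.cons_append, List.mem_cons] at this
      exact this.resolve_left hv
    have : L.Pairwise _ := hpw
    rw [hM, List.cons_append, List.pairwise_cons] at this
    simpa only [hM, List.cons_append] using this.1 v hv'
  · intro v hv
    have hv' : v ∈ s :: M := by
      have := hall v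
      rw [hM, List.mem_append, List.mem_singleton] at this
      exact this.resolve_right hv
    have : L.Pairwise _ := hpw
    rw [hM, List.pairwise_append] at this
    simpa only [hM] using this.2.2 v hv' t (by simp)
  · intro v hs ht
    obtain ⟨a, b, h1, h2, h3⟩ := htri v hs ht
    have := hpw.sublist h3
    simp only [List.pairwise_cons] at this
    exact ⟨⟨a, h1.symm, this.1 v (by simp)⟩, ⟨b, h2, this.2.1 b (by simp)⟩⟩

/-! ### The competitor `K_{2,m}`. -/

namespace PlaneGraph

/-- The rotation of the standard plane drawing of `K_{2,m}`: the dart `(true, s, i)` leads from the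
pole `s` to the middle vertex `i`, and `(false, s, i)` is its reverse. -/
def bipyramidRot (m : ℕ) : Equiv.Perm (Bool × Bool × ZMod m) where
  toFun x := match x with
    | (true, true, i) => (true, true, i + 1)
    | (true, false, i) => (true, false, i - 1)
    | (false, s, i) => (false, !s, i)
  invFun x := match x with
    | (true, true, i) => (true, true, i - 1)
    | (true, false, i) => (true, false, i + 1)
    | (false, s, i) => (false, !s, i)
  left_inv := by rintro ⟨_ | _, _ | _, i⟩ <;> simp
  right_inv := by rintro ⟨_ | _, _ | _, i⟩ <;> simp

/-- Reversal of the darts of `K_{2,m}`. -/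
def bipyramidSymm (m : ℕ) : Equiv.Perm (Bool × Bool × ZMod m) where
  toFun x := (!x.1, x.2)
  invFun x := (!x.1, x.2)
  left_inv := by rintro ⟨_ | _, _⟩ <;> simp
  right_inv := by rintro ⟨_ | _, _⟩ <;> simp

/-- The start vertices of the darts of `K_{2,m}`. -/
def bipyramidFst {m : ℕ} (x : Bool × Bool × ZMod m) : Bool ⊕ ZMod m :=
  if x.1 then Sum.inl x.2.1 else Sum.inr x.2.2

theorem bipyramidRot_pow_true (m : ℕ) (i : ZMod m) (k : ℕ) :
    (bipyramidRot m ^ k) (true, true, i) = (true, true, i + k) := by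
  induction k with
  | zero => simp
  | succ k ih => rw [pow_succ', Equiv.Perm.mul_apply, ih]; simp [bipyramidRot, add_assoc]

theorem bipyramidRot_pow_false (m : ℕ) (i : ZMod m) (k : ℕ) :
    (bipyramidRot m ^ k) (true, false, i) = (true, false, i - k) := by
  induction k with
  | zero => simp
  | succ k ih => rw [pow_succ', Equiv.Perm.mul_apply, ih]; simp [bipyramidRot]; ring

theorem bipyramidRot_sameCycle (m : ℕ) [NeZero m] (x y : Bool × Bool × ZMod m) :
    (bipyramidRot m).SameCycle x y ↔ bipyramidFst x = bipyramidFst y := by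
  constructor
  · have step : ∀ x, bipyramidFst (bipyramidRot m x) = bipyramidFst x := by
      rintro ⟨_ | _, _ | _, i⟩ <;> simp [bipyramidRot, bipyramidFst]
    intro h
    obtain ⟨k, rfl⟩ := h.exists_nat_pow_eq
    clear h
    induction k with
    | zero => rfl
    | succ k ih => rw [pow_succ', Equiv.Perm.mul_apply, step, ← ih]
  · obtain ⟨_ | _, s, i⟩ := x <;> obtain ⟨_ | _, s', j⟩ := y <;>
      simp only [bipyramidFst, Bool.false_eq_true, if_false, if_true, reduceCtorEq,
        Sum.inl.injEq, Sum.inr.injEq, false_implies]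
    · rintro rfl
      by_cases h : s = s'
      · subst h; rfl
      · refine ⟨1, ?_⟩
        have : (!s) = s' := by cases s <;> cases s' <;> simp_all
        simp [bipyramidRot, this]
    · rintro rfl
      cases s
      · exact ⟨((i - j).val : ℕ), by
          rw [zpow_natCast, bipyramidRot_pow_false, ZMod.natCast_zmod_val]; simp⟩
      · exact ⟨((j - i).val : ℕ), by
          rw [zpow_natCast, bipyramidRot_pow_true, ZMod.natCast_zmod_val]; simp⟩

/-- The face permutation of `K_{2,m}`. -/
def bipyramidNext (m : ℕ) : Equiv.Perm (Bool × Bool × ZMod m) :=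
  (bipyramidSymm m).trans (bipyramidRot m).symm

/-- An index for the face of a dart of `K_{2,m}`. -/
def bipyramidFace {m : ℕ} (x : Bool × Bool × ZMod m) : ZMod m :=
  if x.1 = x.2.1 then x.2.2 + 1 else x.2.2

theorem bipyramidNext_sameCycle (m : ℕ) (x y : Bool × Bool × ZMod m) :
    (bipyramidNext m).SameCycle x y ↔ bipyramidFace x = bipyramidFace y := by
  constructor
  · have step : ∀ x, bipyramidFace (bipyramidNext m x) = bipyramidFace x := by
      rintro ⟨_ | _, _ | _, i⟩ <;>
        simp [bipyramidNext, bipyramidSymm, bipyramidRot, bipyramidFace]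
    rintro ⟨k, rfl⟩
    induction k with
    | zero => rfl
    | succ k ih => rw [add_comm, zpow_add, Equiv.Perm.mul_apply, zpow_one, step, ← ih]
    | pred k ih =>
      rw [ih, ← step ((bipyramidNext m ^ (-(k : ℤ) - 1)) x), ← Equiv.Perm.mul_apply, ← zpow_one_add]
      congr 3
      ring
  -- The dart `(true, false, k)` serves as the representative of the face with index `k`.
  · have base : ∀ x, (bipyramidNext m).SameCycle (true, false, bipyramidFace x) x := by
      rintro ⟨_ | _, _ | _, i⟩
      · refine ⟨3, ?_⟩
        simp [bipyramidNext, bipyramidSymm, bipyramidRot, bipyramidFace, zpow_ofNat, pow_succ]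
      · refine ⟨1, ?_⟩
        simp [bipyramidNext, bipyramidSymm, bipyramidRot, bipyramidFace]
      · refine ⟨0, ?_⟩
        simp [bipyramidFace]
      · refine ⟨2, ?_⟩
        simp [bipyramidNext, bipyramidSymm, bipyramidRot, bipyramidFace, zpow_ofNat, pow_succ]
    intro h
    exact (base x).symm.trans (h ▸ base y)

variable {V : Type*}

/-- The graph `K_{2,m}` with relabeled vertices. -/
def bipyramidGraph {m : ℕ} (e : V ≃ Bool ⊕ ZMod m) : SimpleGraph V :=
  (completeBipartiteGraph Bool (ZMod m)).comap e

/-- The darts of `K_{2,m}`. -/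
def bipyramidDart {m : ℕ} (e : V ≃ Bool ⊕ ZMod m) :
    Bool × Bool × ZMod m ≃ (bipyramidGraph e).Dart where
  toFun x := match x with
    | (true, s, i) => ⟨(e.symm (.inl s), e.symm (.inr i)), by simp [bipyramidGraph]⟩
    | (false, s, i) => ⟨(e.symm (.inr i), e.symm (.inl s)), by simp [bipyramidGraph]⟩
  invFun d := match e d.fst, e d.snd with
    | .inl s, .inr i => (true, s, i)
    | .inr i, .inl s => (false, s, i)
    -- Junk values: no dart joins two vertices of the same side.
    | .inl s, .inl _ => (true, s, 0)
    | .inr i, .inr _ => (true, true, i)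
  left_inv := by rintro ⟨_ | _, s, i⟩ <;> simp
  right_inv := by
    rintro ⟨⟨u, v⟩, h⟩
    obtain ⟨u, rfl⟩ := e.symm.surjective u
    obtain ⟨v, rfl⟩ := e.symm.surjective v
    rcases u with u | u <;> rcases v with v | v <;> simp [bipyramidGraph] at h ⊢

theorem bipyramidDart_symm {m : ℕ} (e : V ≃ Bool ⊕ ZMod m) (x : Bool × Bool × ZMod m) :
    (bipyramidDart e x).symm = bipyramidDart e (bipyramidSymm m x) := by
  rcases x with ⟨_ | _, s, i⟩ <;> rfl

theorem bipyramidDart_fst {m : ℕ} (e : V ≃ Bool ⊕ ZMod m) (x : Bool × Bool × ZMod m) :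
    (bipyramidDart e x).fst = e.symm (bipyramidFst x) := by
  rcases x with ⟨_ | _, s, i⟩ <;> rfl

theorem sameCycle_permCongr {α β : Type*} (e : α ≃ β) (f : Equiv.Perm α) (x y : β) :
    (e.permCongr f).SameCycle x y ↔ f.SameCycle (e.symm x) (e.symm y) := by
  have h : ∀ (k : ℤ), (e.permCongr f) ^ k = e.permCongr (f ^ k) := fun k =>
    (map_zpow e.permCongrHom f k).symm
  unfold Equiv.Perm.SameCycle
  refine exists_congr fun k => ?_
  rw [h, Equiv.permCongr_apply, Equiv.eq_symm_apply]

theorem ncard_edgeSet_mul_two [Finite V] (G : SimpleGraph V) :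
    2 * G.edgeSet.ncard = Nat.card G.Dart := by
  classical
  have := Fintype.ofFinite V
  rw [Nat.card_eq_fintype_card, G.dart_card_eq_twice_card_edges, ← SimpleGraph.coe_edgeFinset,
    Set.ncard_coe_finset]

/-- Maximality is used only through this competitor: it gives the lower bound on the number of edges
of a quadrangulation. -/
theorem exists_bipartite_ncard_edgeSet [Fintype V] (hV : 3 ≤ Fintype.card V) :
    ∃ H : PlaneGraph V, H.graph.IsBipartite ∧
      H.graph.edgeSet.ncard = 2 * (Fintype.card V - 2) := by
  classical
  obtain ⟨m, hm⟩ : ∃ m, Fintype.card V = m + 2 := ⟨_, (Nat.sub_add_cancel (by omega)).symm⟩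
  have : NeZero m := ⟨by omega⟩
  have e : V ≃ Bool ⊕ ZMod m := Fintype.equivOfCardEq (by simp [ZMod.card, hm, add_comm])
  have hE : (bipyramidGraph e).edgeSet.ncard = 2 * m := by
    have := ncard_edgeSet_mul_two (bipyramidGraph e)
    rw [← Nat.card_congr (bipyramidDart e)] at this
    simp at this
    omega
  have hnext : (SimpleGraph.Dart.symm_involutive (G := bipyramidGraph e)).toPerm.trans
      ((bipyramidDart e).permCongr (bipyramidRot m)).symm =
      (bipyramidDart e).permCongr (bipyramidNext m) := by
    ext1 d
    obtain ⟨x, rfl⟩ := (bipyramidDart e).surjective d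
    have h1 : (SimpleGraph.Dart.symm_involutive (G := bipyramidGraph e)).toPerm _
      (bipyramidDart e x) = bipyramidDart e (bipyramidSymm m x) := bipyramidDart_symm e x
    rw [Equiv.trans_apply, h1, Equiv.symm_apply_eq]
    simp [Equiv.permCongr_apply, bipyramidNext]
  have hF : Nat.card (Quotient (Equiv.Perm.SameCycle.setoid
      ((SimpleGraph.Dart.symm_involutive (G := bipyramidGraph e)).toPerm.trans
        ((bipyramidDart e).permCongr (bipyramidRot m)).symm))) = m := by
    rw [hnext]
    refine (Nat.card_eq_of_bijective (Quotient.lift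
      (fun d => bipyramidFace ((bipyramidDart e).symm d)) ?_) ⟨?_, ?_⟩).trans (Nat.card_zmod m)
    · intro a b hab
      exact (bipyramidNext_sameCycle m _ _).1 ((sameCycle_permCongr _ _ _ _).1 hab)
    · intro a b
      refine Quotient.inductionOn₂ a b fun a b hab => Quotient.sound ?_
      exact (sameCycle_permCongr _ _ _ _).2 ((bipyramidNext_sameCycle m _ _).2 hab)
    · intro k
      exact ⟨Quotient.mk _ (bipyramidDart e (true, false, k)), by simp [bipyramidFace]⟩
  refine ⟨{ graph := bipyramidGraph e
            connected := ?_
            rot := (bipyramidDart e).permCongr (bipyramidRot m)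
            rot_sameCycle := ?_
            euler := ?_
            outerFace := Quotient.mk _ (bipyramidDart e (true, true, 0)) }, ?_, ?_⟩
  · have hp : ∀ s i, (bipyramidGraph e).Adj (e.symm (.inl s)) (e.symm (.inr i)) := by
      simp [bipyramidGraph]
    have h0 : ∀ v, (bipyramidGraph e).Reachable (e.symm (.inr 0)) v := by
      intro v
      obtain ⟨v, rfl⟩ := e.symm.surjective v
      rcases v with s | i
      · exact (hp s 0).symm.reachable
      · exact (hp true 0).symm.reachable.trans (hp true i).reachable
    exact (SimpleGraph.connected_iff_exists_forall_reachable _).2 ⟨_, h0⟩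
  · intro d d'
    obtain ⟨x, rfl⟩ := (bipyramidDart e).surjective d
    obtain ⟨y, rfl⟩ := (bipyramidDart e).surjective d'
    rw [sameCycle_permCongr, bipyramidDart_fst, bipyramidDart_fst, Equiv.symm_apply_apply,
      Equiv.symm_apply_apply, bipyramidRot_sameCycle, e.symm.injective.eq_iff]
  · rw [hE, hF, hm]
    push_cast
    ring
  · exact ⟨SimpleGraph.Coloring.mk (fun v => if (e v).isLeft then 0 else 1) (by
      intro u v h
      have h : (completeBipartiteGraph Bool (ZMod m)).Adj (e u) (e v) := h
      rcases hu : e u with u | u <;> rcases hv : e v with v | v <;>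
        rw [hu, hv] at h <;> simp at h ⊢)⟩
  · change (bipyramidGraph e).edgeSet.ncard = _
    omega

end PlaneGraph

/-! ### Facial walks: every face of a quadrangulation has length four. -/

theorem SimpleGraph.Connected.mem_of_forall_adj {V : Type*} {G : SimpleGraph V}
    (hG : G.Connected) {S : Set V} (hS : ∀ u ∈ S, ∀ v, G.Adj u v → v ∈ S) {u : V} (hu : u ∈ S)
    (v : V) : v ∈ S := by
  have h := (SimpleGraph.reachable_iff_reflTransGen u v).1 (hG.preconnected u v)
  induction h with
  | refl => exact hu
  | tail _ hbc ih => exact hS _ ih _ hbc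

theorem SimpleGraph.Dart.eq_of_fst_of_snd {V : Type*} {G : SimpleGraph V} {d e : G.Dart}
    (h₁ : d.fst = e.fst) (h₂ : d.snd = e.snd) : d = e :=
  SimpleGraph.Dart.ext _ _ (Prod.ext h₁ h₂)

namespace PlaneGraph

theorem perm_apply_inv {α : Type*} (f : Equiv.Perm α) (x : α) : f (f⁻¹ x) = x :=
  f.apply_symm_apply x

theorem perm_inv_apply {α : Type*} (f : Equiv.Perm α) (x : α) : f⁻¹ (f x) = x :=
  f.symm_apply_apply x

variable {V : Type*} [Fintype V] (Q : PlaneGraph V)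

instance finite_angle : Finite Q.Angle :=
  Finite.of_injective SimpleGraph.Dart.toProd fun _ _ h => SimpleGraph.Dart.ext _ _ h

theorem rot_fst (d : Q.Angle) : (Q.rot d).fst = d.fst :=
  (Q.rot_sameCycle _ _).1 (Equiv.Perm.sameCycle_apply_left.2 (Equiv.Perm.SameCycle.refl _ _))

theorem rot_next (d : Q.Angle) : Q.rot (Q.next d) = d.symm := by
  rw [next_apply, perm_apply_inv]

theorem next_fst (d : Q.Angle) : (Q.next d).fst = d.snd := by
  rw [← rot_fst, rot_next]; rfl

theorem next_symm_rot (d : Q.Angle) : Q.next (Q.rot d).symm = d := by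
  rw [next_apply, SimpleGraph.Dart.symm_symm, perm_inv_apply]

theorem rot_induction {p : Q.Angle → Prop} (hp : ∀ d, p d → p (Q.rot d)) {d e : Q.Angle}
    (h : d.fst = e.fst) (hd : p d) : p e := by
  obtain ⟨k, rfl⟩ := ((Q.rot_sameCycle d e).2 h).exists_nat_pow_eq
  clear h
  induction k with
  | zero => exact hd
  | succ k ih => rw [pow_succ', Equiv.Perm.mul_apply]; exact hp _ ih

/-- The start vertex of the angle that follows the next angle of the same face; in a quadrangular
face, this is the opposite vertex. -/
def opp (d : Q.Angle) : V := (Q.next (Q.next d)).fst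

theorem next_snd (d : Q.Angle) : (Q.next d).snd = Q.opp d := by
  rw [opp, next_fst]

/-- If the walk turns back at `d.snd`, that vertex is a leaf. The rest of the walk then turns back
at a leaf `e.snd` too, and `d.fst` has no further edges, so the whole connected graph has at most
three vertices. Walks of length two are included (`e = d`). -/
theorem opp_ne_fst (hV : 4 ≤ Fintype.card V) {d : Q.Angle}
    (h4 : Q.next (Q.next (Q.next (Q.next d))) = d) : Q.opp d ≠ d.fst := by
  classical
  intro h
  have h1 : Q.next d = d.symm :=
    SimpleGraph.Dart.eq_of_fst_of_snd (Q.next_fst d) ((Q.next_snd d).trans h)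
  obtain ⟨e, he⟩ : ∃ e, e = Q.next d.symm := ⟨_, rfl⟩
  have hef : e.fst = d.fst := by rw [he, next_fst]; rfl
  rw [h1, ← he] at h4
  have h2 : Q.next e = e.symm := by
    refine SimpleGraph.Dart.eq_of_fst_of_snd (Q.next_fst e) ?_
    rw [← next_fst, h4]
    exact hef.symm
  rw [h2] at h4
  have r1 : Q.rot d.symm = d.symm := by have := Q.rot_next d; rwa [h1] at this
  have r2 : Q.rot e = d := by have := Q.rot_next d.symm; rwa [← he] at this
  have r3 : Q.rot e.symm = e.symm := by have := Q.rot_next e; rwa [h2] at this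
  have r4 : Q.rot d = e := by have := Q.rot_next e.symm; rwa [h4] at this
  let S : Finset V := {d.fst, d.snd, e.snd}
  have hS : ∀ v, v ∈ (S : Set V) := by
    refine Q.connected.mem_of_forall_adj ?_ (u := d.fst) (by simp [S])
    intro u hu v huv
    let x : Q.Angle := ⟨(u, v), huv⟩
    simp only [S, Finset.coe_insert, Finset.coe_singleton, Set.mem_insert_iff,
      Set.mem_singleton_iff] at hu ⊢
    rcases hu with hu | hu | hu
    · have : x = d ∨ x = e := by
        refine Q.rot_induction (p := fun x => x = d ∨ x = e) ?_ (d := d) hu.symm (Or.inl rfl)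
        rintro z (rfl | rfl)
        · exact Or.inr r4
        · exact Or.inl r2
      rcases this with h | h
      · exact Or.inr (Or.inl (congrArg (fun z : Q.Angle => z.snd) h))
      · exact Or.inr (Or.inr (congrArg (fun z : Q.Angle => z.snd) h))
    · have : x = d.symm := by
        refine Q.rot_induction (p := fun x => x = d.symm) ?_ (d := d.symm) hu.symm rfl
        rintro z rfl
        exact r1
      exact Or.inl (congrArg (fun z : Q.Angle => z.snd) this)
    · have : x = e.symm := by
        refine Q.rot_induction (p := fun x => x = e.symm) ?_ (d := e.symm) hu.symm rfl
        rintro z rfl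
        exact r3
      exact Or.inl ((congrArg (fun z : Q.Angle => z.snd) this).trans hef)
  have h3 : Fintype.card V ≤ S.card := by
    rw [← Finset.card_univ]
    exact Finset.card_le_card fun v _ => hS v
  have : S.card ≤ 3 := Finset.card_le_three
  omega

theorem isCycleOn_rot (v : V) : Q.rot.IsCycleOn {d : Q.Angle | d.fst = v} := by
  refine ⟨⟨fun d hd => ?_, Q.rot.injective.injOn, fun d hd => ?_⟩, fun d hd e he => ?_⟩
  · exact (Q.rot_fst d).trans hd
  · refine ⟨Q.rot⁻¹ d, ?_, perm_apply_inv _ _⟩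
    change (Q.rot⁻¹ d).fst = v
    rw [← rot_fst, perm_apply_inv]
    exact hd
  · exact (Q.rot_sameCycle d e).2 (hd.trans he.symm)

theorem isCycleOn_next (f : Q.Face) : Q.next.IsCycleOn {d : Q.Angle | Q.face d = f} := by
  have hn : ∀ d, Q.face (Q.next d) = Q.face d := fun d => Quotient.sound
    (Equiv.Perm.sameCycle_apply_left.2 (Equiv.Perm.SameCycle.refl Q.next d))
  refine ⟨⟨fun d hd => ?_, Q.next.injective.injOn, fun d hd => ?_⟩, fun d hd e he => ?_⟩
  · exact (hn d).trans hd
  · refine ⟨Q.next⁻¹ d, ?_, perm_apply_inv _ _⟩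
    change Q.face (Q.next⁻¹ d) = f
    rw [← hn, perm_apply_inv]
    exact hd
  · exact Quotient.exact (hd.trans he.symm)

theorem fst_next_pow_mem_iff {black : Set V}
    (hB : ∀ d : Q.Angle, d.fst ∈ black ↔ d.snd ∉ black) (d : Q.Angle) (k : ℕ) :
    ((Q.next ^ k) d).fst ∈ black ↔ (d.fst ∈ black ↔ Even k) := by
  induction k with
  | zero => simp
  | succ k ih =>
    rw [pow_succ', Equiv.Perm.mul_apply, next_fst]
    have := hB ((Q.next ^ k) d)
    rw [Nat.even_add_one]
    tauto

/-- The length is even because colors alternate along the walk, and length two is excluded by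
`opp_ne_fst`. -/
theorem four_le_card_face (hV : 4 ≤ Fintype.card V) {black : Set V}
    (hB : ∀ d : Q.Angle, d.fst ∈ black ↔ d.snd ∉ black) {f : Q.Face} {A : Finset Q.Angle}
    (hA : (A : Set Q.Angle) = {d | Q.face d = f}) : 4 ≤ A.card := by
  obtain ⟨d, rfl⟩ := Quotient.exists_rep f
  have hcyc : Q.next.IsCycleOn (A : Set Q.Angle) := hA ▸ Q.isCycleOn_next _
  have hd : d ∈ A := by rw [← Finset.mem_coe, hA]; rfl
  have hpos : 0 < A.card := Finset.card_pos.2 ⟨d, hd⟩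
  have hfix : (Q.next ^ A.card) d = d := hcyc.pow_card_apply hd
  have heven : Even A.card := by
    have := Q.fst_next_pow_mem_iff hB d A.card
    rw [hfix] at this
    tauto
  have h2 : A.card ≠ 2 := by
    intro h
    rw [h] at hfix
    have h' : Q.next (Q.next d) = d := hfix
    exact Q.opp_ne_fst hV (d := d) (by rw [h', h']) (by rw [opp, h'])
  obtain ⟨k, hk⟩ := heven
  omega

variable {Q}

theorem IsQuadrangulation.ncard_edgeSet_and_next (hV : 4 ≤ Fintype.card V)
    (hQ : Q.IsQuadrangulation) {black : Set V}
    (hB : ∀ d : Q.Angle, d.fst ∈ black ↔ d.snd ∉ black) :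
    Q.graph.edgeSet.ncard = 2 * (Fintype.card V - 2) ∧
      ∀ d, Q.next (Q.next (Q.next (Q.next d))) = d := by
  classical
  have := Fintype.ofFinite Q.Angle
  have := Fintype.ofFinite Q.Face
  obtain ⟨H, hH, hHe⟩ := exists_bipartite_ncard_edgeSet (V := V) (by omega)
  have hle := hQ.2 H hH
  have heuler := Q.euler
  change (Fintype.card V : ℤ) - (Q.graph.edgeSet.ncard : ℤ) + (Nat.card Q.Face : ℤ) = 2 at heuler
  have hdart := ncard_edgeSet_mul_two Q.graph
  let A : Q.Face → Finset Q.Angle := fun f => {d | Q.face d = f}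
  have hA : ∀ f, (A f : Set Q.Angle) = {d | Q.face d = f} := fun f => by simp [A]
  have hA4 : ∀ f, 4 ≤ (A f).card := fun f => Q.four_le_card_face hV hB (hA f)
  have hsum : Nat.card Q.Angle = ∑ f, (A f).card := by
    rw [Nat.card_eq_fintype_card, ← Finset.card_univ]
    exact Finset.card_eq_sum_card_fiberwise (fun _ _ => Finset.mem_coe.2 (Finset.mem_univ _))
  have hconst : ∑ _f : Q.Face, 4 = 4 * Nat.card Q.Face := by
    simp [mul_comm]
  have hge : ∑ _f : Q.Face, 4 ≤ ∑ f, (A f).card := Finset.sum_le_sum fun f _ => hA4 f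
  -- Twice the edge number is the sum of the face lengths. With Euler's formula and the bound from
  -- `H`, the inequality `hge` is squeezed to an equality.
  have heq : ∑ _f : Q.Face, 4 = ∑ f, (A f).card := by
    change 2 * _ = Nat.card Q.Angle at hdart
    omega
  refine ⟨?_, fun d => ?_⟩
  · change 2 * _ = Nat.card Q.Angle at hdart
    omega
  · have h := (Finset.sum_eq_sum_iff_of_le fun f _ => hA4 f).1 heq (Q.face d) (Finset.mem_univ _)
    have hcyc : Q.next.IsCycleOn (A (Q.face d) : Set Q.Angle) := hA _ ▸ Q.isCycleOn_next _
    have := hcyc.pow_card_apply (a := d) (by simp [A])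
    rw [← h] at this
    exact this

end PlaneGraph

/-! ### The graph of diagonals and its connectivity after deleting a vertex. -/

namespace PlaneGraph

variable {V : Type*} [Fintype V] {Q : PlaneGraph V}

theorem next_next_next (h4 : ∀ d, Q.next (Q.next (Q.next (Q.next d))) = d) (d : Q.Angle) :
    Q.next (Q.next (Q.next d)) = (Q.rot d).symm :=
  Q.next.injective ((h4 d).trans (Q.next_symm_rot d).symm)

variable (Q) in
/-- The graph whose edges are the diagonals of the faces. -/
def diagonalGraph : SimpleGraph V :=
  SimpleGraph.fromRel fun a b => ∃ d : Q.Angle, d.fst = a ∧ Q.opp d = b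

theorem diagonalGraph_adj (h4 : ∀ d, Q.next (Q.next (Q.next (Q.next d))) = d)
    (hopp : ∀ d, Q.opp d ≠ d.fst) {a b : V} :
    Q.diagonalGraph.Adj a b ↔ ∃ d : Q.Angle, d.fst = a ∧ Q.opp d = b := by
  rw [diagonalGraph, SimpleGraph.fromRel_adj]
  constructor
  · rintro ⟨-, h | ⟨d, rfl, rfl⟩⟩
    · exact h
    · exact ⟨Q.next (Q.next d), rfl, by rw [opp, h4]⟩
  · rintro ⟨d, rfl, rfl⟩
    exact ⟨(hopp d).symm, Or.inl ⟨d, rfl, rfl⟩⟩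

variable (Q) in
/-- Two vertices are linked if some path of diagonals of faces that avoids `v` joins them. -/
def Linked (v : V) : V → V → Prop :=
  Relation.ReflTransGen fun a b => Q.diagonalGraph.Adj a b ∧ a ≠ v ∧ b ≠ v

theorem Linked.symm {v a b : V} (h : Q.Linked v a b) : Q.Linked v b a := by
  unfold Linked at *
  induction h with
  | refl => exact Relation.ReflTransGen.refl
  | tail _ h ih => exact ih.head ⟨h.1.symm, h.2.2, h.2.1⟩

/-- Consecutive neighbors of a vertex are opposite corners of a face, hence joined by a diagonal. If
`v` is a neighbor, it occurs only once in the rotation, so starting just after it reaches all the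
others without crossing it. -/
theorem linked_of_fst_eq (h4 : ∀ d, Q.next (Q.next (Q.next (Q.next d))) = d)
    (hopp : ∀ d, Q.opp d ≠ d.fst) {v : V} {x y : Q.Angle} (hxy : x.fst = y.fst)
    (hx : x.snd ≠ v) (hy : y.snd ≠ v) : Q.Linked v x.snd y.snd := by
  have step : ∀ z : Q.Angle, z.snd ≠ v → (Q.rot z).snd ≠ v →
      Q.Linked v z.snd (Q.rot z).snd := by
    intro z h1 h2
    refine Relation.ReflTransGen.single ⟨SimpleGraph.Adj.symm ?_, h1, h2⟩
    rw [diagonalGraph_adj h4 hopp]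
    exact ⟨(Q.rot z).symm, rfl, by rw [opp, next_symm_rot, next_fst]⟩
  by_cases h : ∃ z₀ : Q.Angle, z₀.fst = x.fst ∧ z₀.snd = v
  · obtain ⟨z₀, hz₀, hv⟩ := h
    have main : ∀ y : Q.Angle, x.fst = y.fst → y.snd ≠ v → Q.Linked v (Q.rot z₀).snd y.snd := by
      intro y hxy hy
      refine (Q.rot_induction
        (p := fun z => z.fst = z₀.fst ∧ (z.snd = v ∨ Q.Linked v (Q.rot z₀).snd z.snd))
        ?_ (hz₀.trans hxy) ⟨rfl, Or.inl hv⟩).2.resolve_left hy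
      rintro z ⟨hz, hz'⟩
      refine ⟨(Q.rot_fst z).trans hz, ?_⟩
      by_cases h1 : (Q.rot z).snd = v
      · exact Or.inl h1
      right
      by_cases h2 : z.snd = v
      · rw [SimpleGraph.Dart.eq_of_fst_of_snd hz (h2.trans hv.symm)]
        exact Relation.ReflTransGen.refl
      · exact (hz'.resolve_left h2).trans (step z h2 h1)
    exact (main x rfl hx).symm.trans (main y hxy hy)
  · refine (Q.rot_induction (p := fun z => z.fst = x.fst ∧ Q.Linked v x.snd z.snd)
        ?_ hxy ⟨rfl, Relation.ReflTransGen.refl⟩).2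
    rintro z ⟨hz, hz'⟩
    have hz'' := (Q.rot_fst z).trans hz
    exact ⟨hz'', hz'.trans (step z (fun hv => h ⟨z, hz, hv⟩) fun hv => h ⟨_, hz'', hv⟩)⟩

/-- Consecutive faces around `d.fst` share an edge. Both opposite corners are neighbors of the other
end of this edge, and rotating around that end links them. -/
theorem linked_opp (h4 : ∀ d, Q.next (Q.next (Q.next (Q.next d))) = d)
    (hopp : ∀ d, Q.opp d ≠ d.fst) {d e : Q.Angle} (hde : d.fst = e.fst) :
    Q.Linked d.fst (Q.opp d) (Q.opp e) := by
  refine (Q.rot_induction (p := fun z => z.fst = d.fst ∧ Q.Linked d.fst (Q.opp d) (Q.opp z))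
    ?_ hde ⟨rfl, Relation.ReflTransGen.refl⟩).2
  rintro z ⟨hz, hz'⟩
  have hz'' := (Q.rot_fst z).trans hz
  refine ⟨hz'', hz'.trans ?_⟩
  have h := linked_of_fst_eq h4 hopp (v := d.fst) (x := (Q.next (Q.next z)).symm)
    (y := Q.next (Q.rot z)) ?_ ?_ ?_
  · rwa [next_snd] at h
  · rw [next_fst]
    change (Q.next (Q.next z)).snd = _
    rw [← next_fst, next_next_next h4]
    rfl
  · exact hz ▸ hopp z
  · rw [next_snd, ← hz'']
    exact hopp _

/-- Connectivity of `Q` is transferred to the black diagonals. The invariant `S` spreads along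
edges: at a white vertex it says that all neighbors other than `d.fst` are linked, which
`linked_of_fst_eq` deduces from one of them, or `linked_opp` when the edge comes from `d.fst`
itself. -/
theorem linked_of_mem (h4 : ∀ d, Q.next (Q.next (Q.next (Q.next d))) = d)
    (hopp : ∀ d, Q.opp d ≠ d.fst) {black : Set V}
    (hB : ∀ d : Q.Angle, d.fst ∈ black ↔ d.snd ∉ black) (d : Q.Angle) (hd : d.fst ∈ black)
    {a : V} (ha : a ∈ black) (had : a ≠ d.fst) : Q.Linked d.fst (Q.opp d) a := by
  let S : Set V := {x | (x ∈ black → x = d.fst ∨ Q.Linked d.fst (Q.opp d) x) ∧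
    (x ∉ black → ∀ e : Q.Angle, e.fst = x → e.snd ≠ d.fst → Q.Linked d.fst (Q.opp d) e.snd)}
  refine ((Q.connected.mem_of_forall_adj (S := S) ?_ (u := d.fst)
    ⟨fun _ => Or.inl rfl, fun h => absurd hd h⟩ a).1 ha).resolve_left had
  rintro u ⟨hu1, hu2⟩ v huv
  let x : Q.Angle := ⟨(u, v), huv⟩
  have hx : u ∈ black ↔ v ∉ black := hB x
  by_cases hu : u ∈ black
  · refine ⟨fun hv => absurd hv (hx.1 hu), fun _ e he hev => ?_⟩
    by_cases h1 : x.fst = d.fst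
    · refine (linked_opp h4 hopp h1.symm).trans ?_
      rw [← next_snd]
      refine linked_of_fst_eq h4 hopp ?_ ?_ hev
      · rw [next_fst]
        exact he.symm
      · rw [next_snd, ← h1]
        exact hopp x
    · exact ((hu1 hu).resolve_left h1).trans
        (linked_of_fst_eq h4 hopp (x := x.symm) he.symm h1 hev)
  · refine ⟨fun _ => ?_, fun hv => absurd (hx.2 hv) hu⟩
    by_cases hv : v = d.fst
    · exact Or.inl hv
    · exact Or.inr (hu2 hu x rfl hv)

theorem exists_numbering (h4 : ∀ d, Q.next (Q.next (Q.next (Q.next d))) = d)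
    (hopp : ∀ d, Q.opp d ≠ d.fst) {black : Set V}
    (hB : ∀ d : Q.Angle, d.fst ∈ black ↔ d.snd ∉ black)
    (hdart : ∀ v, ∃ d : Q.Angle, d.fst = v) {s t : V} (hs : s ∈ black) (ht : t ∈ black)
    (hst : s ≠ t) :
    ∃ h : V → ℕ, (∀ d : Q.Angle, d.fst ∈ black → h d.fst ≠ h (Q.opp d)) ∧
      (∀ v ∈ black, v ≠ s → h s < h v) ∧ (∀ v ∈ black, v ≠ t → h v < h t) ∧
      ∀ v ∈ black, v ≠ s → v ≠ t →
        (∃ d : Q.Angle, d.fst = v ∧ h (Q.opp d) < h v) ∧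
        ∃ d : Q.Angle, d.fst = v ∧ h v < h (Q.opp d) := by
  have hoppB : ∀ d : Q.Angle, d.fst ∈ black → Q.opp d ∈ black := by
    intro d hd
    have h1 := hB d
    have h2 := hB (Q.next d)
    rw [next_fst, next_snd] at h2
    tauto
  let G : SimpleGraph black := Q.diagonalGraph.comap Subtype.val
  have hG : ∀ v a b : black, a ≠ v → b ≠ v →
      Relation.ReflTransGen (fun x y => G.Adj x y ∧ y ≠ v) a b := by
    have lift : ∀ (v a : black) (c : V), Q.Linked v a c → ∃ hc : c ∈ black,
        Relation.ReflTransGen (fun x y => G.Adj x y ∧ y ≠ v) a ⟨c, hc⟩ := by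
      intro v a c hac
      unfold Linked at hac
      induction hac with
      | refl => exact ⟨a.2, Relation.ReflTransGen.refl⟩
      | tail _ hbc ih =>
        obtain ⟨hb, ih⟩ := ih
        obtain ⟨d, rfl, rfl⟩ := (diagonalGraph_adj h4 hopp).1 hbc.1
        refine ⟨hoppB d hb, ih.tail ⟨hbc.1, fun h => hbc.2.2 (congrArg Subtype.val h)⟩⟩
    intro v a b hav hbv
    obtain ⟨d, hd⟩ := hdart v
    have hdB : d.fst ∈ black := hd ▸ v.2
    have ha := linked_of_mem h4 hopp hB d hdB a.2 (fun h => hav (Subtype.ext (h.trans hd)))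
    have hb := linked_of_mem h4 hopp hB d hdB b.2 (fun h => hbv (Subtype.ext (h.trans hd)))
    rw [hd] at ha hb
    exact (lift v a b (ha.symm.trans hb)).2
  obtain ⟨h, hinj, hmin, hmax, hmid⟩ :=
    G.exists_st_numbering hG (s := ⟨s, hs⟩) (t := ⟨t, ht⟩) (fun h => hst (congrArg Subtype.val h))
  -- The numbering is extended by 0 to the white vertices, where its values play no role.
  have hext : ∀ v : black, Function.extend Subtype.val h 0 (v : V) = h v := fun v =>
    Subtype.val_injective.extend_apply h 0 v
  refine ⟨Function.extend Subtype.val h 0, ?_, ?_, ?_, ?_⟩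
  · intro d hd heq
    rw [hext ⟨_, hd⟩, hext ⟨_, hoppB d hd⟩] at heq
    exact hopp d (congrArg Subtype.val (hinj heq)).symm
  · intro v hv hvs
    rw [hext ⟨_, hv⟩, hext ⟨_, hs⟩]
    exact hmin _ fun h => hvs (congrArg Subtype.val h)
  · intro v hv hvt
    rw [hext ⟨_, hv⟩, hext ⟨_, ht⟩]
    exact hmax _ fun h => hvt (congrArg Subtype.val h)
  · intro v hv hvs hvt
    obtain ⟨⟨a, hva, ha⟩, ⟨b, hvb, hb⟩⟩ := hmid ⟨v, hv⟩ (fun h => hvs (congrArg Subtype.val h))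
      (fun h => hvt (congrArg Subtype.val h))
    obtain ⟨d, hd, hd'⟩ := (diagonalGraph_adj h4 hopp).1 hva
    obtain ⟨e, he, he'⟩ := (diagonalGraph_adj h4 hopp).1 hvb
    refine ⟨⟨d, hd, ?_⟩, ⟨e, he, ?_⟩⟩
    · rw [hd', hext, hext ⟨v, hv⟩]; exact ha
    · rw [he', hext, hext ⟨v, hv⟩]; exact hb

end PlaneGraph

/-! ### The labeling defined by a numbering. -/

namespace PlaneGraph

variable {V : Type*} [Fintype V] {Q : PlaneGraph V}

open Classical in
variable (Q) in
/-- The labeling of the angles by a numbering of the black vertices: in every face, the angle at the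
black vertex with the smaller number is labeled `0`, the angle at the other black vertex is labeled
`1`, and the angles at the white vertices repeat the preceding label of the face. -/
noncomputable def numberingLabel (black : Set V) (h : V → ℕ) (d : Q.Angle) : Fin 2 :=
  if d.fst ∈ black then if h d.fst < h (Q.opp d) then 0 else 1
  else if h (Q.rot d).snd < h d.snd then 0 else 1

section Label

variable {black : Set V} {h : V → ℕ}

theorem numberingLabel_of_mem {d : Q.Angle} (hd : d.fst ∈ black) :
    Q.numberingLabel black h d = if h d.fst < h (Q.opp d) then 0 else 1 := if_pos hd

theorem numberingLabel_of_notMem {d : Q.Angle} (hd : d.fst ∉ black) :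
    Q.numberingLabel black h d = if h (Q.rot d).snd < h d.snd then 0 else 1 := if_neg hd

theorem numberingLabel_next_of_mem (hB : ∀ d : Q.Angle, d.fst ∈ black ↔ d.snd ∉ black)
    {d : Q.Angle} (hd : d.fst ∈ black) :
    Q.numberingLabel black h (Q.next d) = Q.numberingLabel black h d := by
  have h1 : (Q.next d).fst ∉ black := by rw [next_fst]; exact (hB d).1 hd
  rw [numberingLabel_of_mem hd, numberingLabel_of_notMem h1, rot_next, next_snd]
  rfl

/-- The corner before a white angle `d` lies at `(Q.rot d).snd`, the corner after it at `d.snd`.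
These two are opposite, so exactly one of them has the smaller number. -/
theorem numberingLabel_next_of_notMem (h4 : ∀ d, Q.next (Q.next (Q.next (Q.next d))) = d)
    (hB : ∀ d : Q.Angle, d.fst ∈ black ↔ d.snd ∉ black)
    (hne : ∀ d : Q.Angle, d.fst ∈ black → h d.fst ≠ h (Q.opp d))
    {d : Q.Angle} (hd : d.fst ∉ black) :
    Q.numberingLabel black h (Q.next d) ≠ Q.numberingLabel black h d := by
  have h1 : (Q.next d).fst ∈ black := by
    rw [next_fst]
    by_contra h
    exact hd ((hB d).2 h)
  have h2 := hne _ h1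
  have h3 : Q.opp (Q.next d) = (Q.rot d).snd := by rw [opp, next_next_next h4]; rfl
  rw [numberingLabel_of_mem h1, numberingLabel_of_notMem hd]
  rw [h3, next_fst] at h2 ⊢
  split_ifs <;> omega

/-- The four labels at an edge are those of `d`, `d.symm` and their `next` angles. One of the two
steps leaves a black corner and keeps the label, the other leaves a white corner and changes it. -/
theorem numberingLabel_edge_rule (h4 : ∀ d, Q.next (Q.next (Q.next (Q.next d))) = d)
    (hB : ∀ d : Q.Angle, d.fst ∈ black ↔ d.snd ∉ black)
    (hne : ∀ d : Q.Angle, d.fst ∈ black → h d.fst ≠ h (Q.opp d)) (d : Q.Angle) :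
    Xor (Q.numberingLabel black h d = Q.numberingLabel black h (Q.rot⁻¹ d))
      (Q.numberingLabel black h d.symm = Q.numberingLabel black h (Q.rot⁻¹ d.symm)) := by
  have e1 : Q.rot⁻¹ d = Q.next d.symm := by rw [next_apply, SimpleGraph.Dart.symm_symm]
  have e2 : Q.rot⁻¹ d.symm = Q.next d := (Q.next_apply d).symm
  rw [e1, e2]
  by_cases hd : d.fst ∈ black
  · have h1 := numberingLabel_next_of_mem (h := h) hB hd
    have h2 := numberingLabel_next_of_notMem h4 hB hne (d := d.symm) ((hB d).1 hd)
    rw [h1]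
    generalize Q.numberingLabel black h d = p at *
    generalize Q.numberingLabel black h d.symm = q at *
    generalize Q.numberingLabel black h (Q.next d.symm) = r at *
    clear h1
    decide +revert
  · have h1 := numberingLabel_next_of_notMem h4 hB hne hd
    have h2 := numberingLabel_next_of_mem (h := h) hB (d := d.symm)
      (by by_contra h; exact hd ((hB d).2 h))
    rw [h2]
    generalize Q.numberingLabel black h d = p at *
    generalize Q.numberingLabel black h d.symm = q at *
    generalize Q.numberingLabel black h (Q.next d) = r at *
    clear h2
    decide +revert

theorem numberingLabel_face (h4 : ∀ d, Q.next (Q.next (Q.next (Q.next d))) = d)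
    (hB : ∀ d : Q.Angle, d.fst ∈ black ↔ d.snd ∉ black)
    (hne : ∀ d : Q.Angle, d.fst ∈ black → h d.fst ≠ h (Q.opp d)) {d : Q.Angle}
    (hd : d.fst ∈ black) (hlt : h d.fst < h (Q.opp d)) :
    Q.numberingLabel black h d = 0 ∧ Q.numberingLabel black h (Q.next d) = 0 ∧
      Q.numberingLabel black h ((Q.next ^ 2) d) = 1 ∧
      Q.numberingLabel black h ((Q.next ^ 3) d) = 1 := by
  have h0 : Q.numberingLabel black h d = 0 := by rw [numberingLabel_of_mem hd, if_pos hlt]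
  have h1 := (numberingLabel_next_of_mem (h := h) hB hd).trans h0
  have hd1 : (Q.next d).fst ∉ black := by rw [next_fst]; exact (hB d).1 hd
  have h2 := numberingLabel_next_of_notMem h4 hB hne hd1
  have hd2 : (Q.next (Q.next d)).fst ∈ black := by
    rw [next_fst]
    by_contra h
    exact hd1 ((hB _).2 h)
  have h3 := numberingLabel_next_of_mem (h := h) hB hd2
  change _ ∧ _ ∧ Q.numberingLabel black h (Q.next (Q.next d)) = 1 ∧
      Q.numberingLabel black h (Q.next (Q.next (Q.next d))) = 1
  rw [h3]
  omega

/-- Rotating past the neighbor with the largest number goes down, which gives 0; past the smallest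
it goes up, which gives 1. -/
theorem exists_numberingLabel_of_notMem (hB : ∀ d : Q.Angle, d.fst ∈ black ↔ d.snd ∉ black)
    (hne : ∀ d : Q.Angle, d.fst ∈ black → h d.fst ≠ h (Q.opp d))
    (hdart : ∀ v, ∃ d : Q.Angle, d.fst = v) {v : V} (hv : v ∉ black) :
    (∃ d : Q.Angle, d.fst = v ∧ Q.numberingLabel black h d = 0) ∧
      ∃ d : Q.Angle, d.fst = v ∧ Q.numberingLabel black h d = 1 := by
  obtain ⟨d₀, hd₀⟩ := hdart v
  have hne' : ∀ d : Q.Angle, d.fst = v → h (Q.rot d).snd ≠ h d.snd := by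
    intro d hd
    have h1 := hne (Q.rot d).symm (by
      by_contra h
      exact hv (hd ▸ Q.rot_fst d ▸ (hB (Q.rot d)).2 h))
    rwa [opp, next_symm_rot, next_fst] at h1
  have hfin : Set.Finite {d : Q.Angle | d.fst = v} := Set.toFinite _
  constructor
  · obtain ⟨d, hd, hmax⟩ := hfin.exists_maximalFor (fun d => h d.snd) _ ⟨d₀, hd₀⟩
    have hd' : d.fst = v := hd
    refine ⟨d, hd', ?_⟩
    rw [numberingLabel_of_notMem (hd'.symm ▸ hv), if_pos]
    have h1 := hmax (j := Q.rot d) ((Q.rot_fst d).trans hd')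
    have h2 := hne' d hd'
    simp only at h1
    omega
  · obtain ⟨d, hd, hmin⟩ := hfin.exists_minimalFor (fun d => h d.snd) _ ⟨d₀, hd₀⟩
    have hd' : d.fst = v := hd
    refine ⟨d, hd', ?_⟩
    rw [numberingLabel_of_notMem (hd'.symm ▸ hv), if_neg]
    have h1 := hmin (j := Q.rot d) ((Q.rot_fst d).trans hd')
    simp only at h1
    omega

end Label

/-! ### The vertex rule by double counting. -/

/-- If every vertex except two sees both labels and the edge rule holds, then the vertex rule
holds, since there are only two label changes to spend on each vertex. -/
theorem vertex_rule_of_edge_rule (hV : 2 ≤ Fintype.card V)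
    (hE : Q.graph.edgeSet.ncard = 2 * (Fintype.card V - 2)) {lab : Q.Angle → Fin 2}
    (hedge : ∀ d : Q.graph.Dart,
      Xor (lab d = lab (Q.rot⁻¹ d)) (lab d.symm = lab (Q.rot⁻¹ d.symm)))
    {s t : V} (hst : s ≠ t)
    (hlab : ∀ v, v ≠ s → v ≠ t →
      (∃ d : Q.Angle, d.fst = v ∧ lab d = 0) ∧ ∃ d : Q.Angle, d.fst = v ∧ lab d = 1)
    {v : V} (hvs : v ≠ s) (hvt : v ≠ t) :
    ∃ a : Q.Angle, a.fst = v ∧ ∃ k : ℕ, 0 < k ∧ k < (Q.graph.neighborSet v).ncard ∧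
      (∀ i < k, lab ((Q.rot ^ i) a) = 0) ∧
      (∀ i, k ≤ i → i < (Q.graph.neighborSet v).ncard → lab ((Q.rot ^ i) a) = 1) := by
  classical
  -- Without a change from `p` to `q`, the label `p` would persist all the way around `v`.
  have hchange : ∀ v, v ≠ s → v ≠ t → ∀ p q : Fin 2, p ≠ q →
      ∃ d : Q.Angle, d.fst = v ∧ lab (Q.rot⁻¹ d) = p ∧ lab d = q := by
    intro v hvs hvt p q hpq
    by_contra! hcon
    obtain ⟨⟨d₀, hd₀, h0⟩, ⟨d₁, hd₁, h1⟩⟩ := hlab v hvs hvt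
    have key : ∀ x y : Q.Angle, x.fst = v → y.fst = v → lab x = p → lab y = p := by
      intro x y hx hy hxp
      refine (Q.rot_induction (p := fun z => z.fst = v ∧ lab z = p) ?_ (hx.trans hy.symm)
        ⟨hx, hxp⟩).2
      rintro z ⟨hz, hzp⟩
      have hz' := (Q.rot_fst z).trans hz
      have := hcon _ hz' (by rwa [perm_inv_apply])
      exact ⟨hz', by omega⟩
    have k1 := key d₀ d₁ hd₀ hd₁
    have k2 := key d₁ d₀ hd₁ hd₀
    omega
  let A : Finset Q.graph.Dart := {d | lab d ≠ lab (Q.rot⁻¹ d)}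
  have hA : A.card = 2 * (Fintype.card V - 2) := by
    -- By the edge rule, reversal exchanges `A` with its complement, so `A` contains exactly half of
    -- the darts.
    have h1 : A.card = Aᶜ.card := by
      refine Finset.card_bij (fun d _ => d.symm) ?_ ?_ ?_
      · intro d hd
        have := hedge d
        simp only [A, Finset.mem_compl, Finset.mem_filter, Finset.mem_univ, true_and] at hd ⊢
        simp only [Xor] at this
        tauto
      · intro d _ e _ hde
        exact SimpleGraph.Dart.symm_involutive.injective hde
      · intro d hd
        refine ⟨d.symm, ?_, d.symm_symm⟩
        have := hedge d
        simp only [A, Finset.mem_compl, Finset.mem_filter, Finset.mem_univ, true_and] at hd ⊢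
        simp only [Xor] at this
        tauto
    have h2 := A.card_add_card_compl
    have h3 := ncard_edgeSet_mul_two Q.graph
    rw [Nat.card_eq_fintype_card] at h3
    omega
  have hsum : A.card = ∑ v, (A.filter fun d => d.fst = v).card :=
    Finset.card_eq_sum_card_fiberwise fun _ _ => Finset.mem_coe.2 (Finset.mem_univ _)
  have htwo : ∀ v, v ≠ s → v ≠ t → 2 ≤ (A.filter fun d => d.fst = v).card := by
    intro v hvs hvt
    obtain ⟨d, hd, hd1, hd2⟩ := hchange v hvs hvt 0 1 (by decide)
    obtain ⟨e, he, he1, he2⟩ := hchange v hvs hvt 1 0 (by decide)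
    have hde : d ≠ e := by rintro rfl; simp [hd2] at he2
    rw [← Finset.card_pair hde]
    refine Finset.card_le_card ?_
    simp [-Equiv.Perm.coe_inv, Finset.insert_subset_iff, A, hd, hd1, hd2, he, he1, he2]
  have hle : ∀ v ∈ Finset.univ, (if v ∈ ({s, t} : Finset V) then 0 else 2) ≤
      (A.filter fun d => d.fst = v).card := by
    intro v _
    split_ifs with hv
    · exact Nat.zero_le _
    · simp only [Finset.mem_insert, Finset.mem_singleton, not_or] at hv
      exact htwo v hv.1 hv.2
  have hconst : ∑ v : V, (if v ∈ ({s, t} : Finset V) then 0 else 2) =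
      2 * (Fintype.card V - 2) := by
    have h1 := Finset.card_add_card_compl ({s, t} : Finset V)
    rw [Finset.card_pair hst] at h1
    rw [Finset.sum_ite, Finset.sum_const_zero, zero_add, Finset.sum_const, smul_eq_mul, mul_comm]
    have h2 : Finset.univ.filter (fun v => v ∉ ({s, t} : Finset V)) = {s, t}ᶜ := by
      ext; simp
    rw [h2]
    omega
  -- The lower bounds, 0 at `s` and `t` and 2 elsewhere, already add up to the size of `A`, so each
  -- of them is attained.
  have hcard : (A.filter fun d => d.fst = v).card = 2 := by
    have := (Finset.sum_eq_sum_iff_of_le hle).1 (by rw [hconst, ← hsum, hA]) v (Finset.mem_univ v)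
    rw [← this, if_neg (by simp [hvs, hvt])]
  obtain ⟨a, ha, ha1, ha2⟩ := hchange v hvs hvt 1 0 (by decide)
  obtain ⟨e, he, he1, he2⟩ := hchange v hvs hvt 0 1 (by decide)
  -- A second change from 1 to 0, together with `a` and `e`, would make three changes at `v`.
  have huniq : ∀ b : Q.Angle, b.fst = v → lab (Q.rot⁻¹ b) = 1 → lab b = 0 → b = a := by
    intro b hb hb1 hb2
    by_contra hba
    have hbe : b ≠ e := by rintro rfl; simp [hb2] at he2
    have hae : a ≠ e := by rintro rfl; simp [ha2] at he2
    have h3 : ({b, a, e} : Finset Q.graph.Dart).card = 3 := Finset.card_eq_three.2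
      ⟨b, a, e, hba, hbe, hae, rfl⟩
    have h4 : ({b, a, e} : Finset Q.graph.Dart).card ≤ (A.filter fun d => d.fst = v).card := by
      refine Finset.card_le_card ?_
      simp [-Equiv.Perm.coe_inv, Finset.insert_subset_iff, A, ha, ha1, ha2, he, he1, he2, hb, hb1, hb2]
    omega
  have hdeg : (Q.graph.neighborSet v).ncard =
      (Finset.univ.filter fun d : Q.graph.Dart => d.fst = v).card := by
    rw [Set.ncard_eq_toFinset_card', Set.toFinset_card, SimpleGraph.card_neighborSet_eq_degree]
    convert (Q.graph.dart_fst_fiber_card_eq_degree v).symm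
  have hcyc : Q.rot.IsCycleOn
      ((Finset.univ.filter fun d : Q.graph.Dart => d.fst = v : Finset _) : Set Q.graph.Dart) := by
    have := Q.isCycleOn_rot v
    simpa using this
  have hpow : ∀ n, (Q.rot ^ n) a = a ↔ (Q.graph.neighborSet v).ncard ∣ n := by
    intro n
    rw [hdeg]
    exact hcyc.pow_apply_eq (by simp [ha])
  generalize (Q.graph.neighborSet v).ncard = m at hpow
  have hfst : ∀ n, ((Q.rot ^ n) a).fst = v := by
    intro n
    induction n with
    | zero => exact ha
    | succ n ih => rw [pow_succ', Equiv.Perm.mul_apply, rot_fst, ih]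
  have hpos : 0 < m := by
    rw [Nat.pos_iff_ne_zero]
    rintro rfl
    have h1 := (hpow (orderOf Q.rot)).1 (by rw [pow_orderOf_eq_one]; rfl)
    exact (orderOf_pos Q.rot).ne' (Nat.eq_zero_of_zero_dvd h1)
  have hlast : lab ((Q.rot ^ (m - 1)) a) = 1 := by
    have h1 : Q.rot ((Q.rot ^ (m - 1)) a) = a := by
      rw [← Equiv.Perm.mul_apply, ← pow_succ', Nat.sub_add_cancel hpos]
      exact (hpow m).2 dvd_rfl
    rw [← ha1, Equiv.Perm.eq_inv_iff_eq.2 h1]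
  have hex : ∃ k, lab ((Q.rot ^ k) a) = 1 := ⟨_, hlast⟩
  refine ⟨a, ha, Nat.find hex, ?_, ?_, ?_, ?_⟩
  · rw [Nat.find_pos]
    simp [ha2]
  · have := Nat.find_min' hex hlast
    omega
  · intro i hi
    have := Nat.find_min hex hi
    omega
  -- A 0 after the first 1 would produce another change from 1 to 0, hence a return to `a` before
  -- the full turn.
  · intro i hi
    induction i, hi using Nat.le_induction with
    | base => exact fun _ => Nat.find_spec hex
    | succ i hi ih =>
      intro him
      have h1 := ih (by omega)
      by_contra h2
      have h3 := huniq ((Q.rot ^ (i + 1)) a) (hfst _)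
        (by rwa [pow_succ', Equiv.Perm.mul_apply, perm_inv_apply]) (by omega)
      have := Nat.le_of_dvd (by omega) ((hpow _).1 h3)
      omega

end PlaneGraph

/-! ### Assembly. -/

theorem mainTheorem1 {V : Type*} [Fintype V] (hV : 4 ≤ Fintype.card V)
    (Q : PlaneGraph V) (hQ : Q.IsQuadrangulation)
    (black white : Set V) (hcol : Q.graph.IsBipartiteWith black white) :
    (black ∩ Q.outerVertices).ncard = 2 ∧
      ∀ s₀ ∈ black ∩ Q.outerVertices, ∀ s₁ ∈ black ∩ Q.outerVertices, s₀ ≠ s₁ →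
        ∃ lab : Q.Angle → Fin 2, Q.IsStrongLabeling black s₀ s₁ lab := by
  have hB : ∀ d : Q.Angle, d.fst ∈ black ↔ d.snd ∉ black := by
    intro d
    have h1 := hcol.mem_of_adj d.adj
    have h2 : ∀ x, x ∈ black → x ∉ white := fun x h h' =>
      Set.disjoint_left.1 hcol.disjoint h h'
    have := h2 d.fst
    have := h2 d.snd
    tauto
  obtain ⟨hE, h4⟩ := hQ.ncard_edgeSet_and_next hV hB
  have hopp : ∀ d, Q.opp d ≠ d.fst := fun d => Q.opp_ne_fst hV (h4 d)
  have hdart : ∀ v, ∃ d : Q.Angle, d.fst = v := by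
    intro v
    have : Nontrivial V := Fintype.one_lt_card_iff_nontrivial.1 (by omega)
    obtain ⟨w, hw⟩ := Q.connected.preconnected.exists_adj_of_nontrivial v
    exact ⟨⟨(v, w), hw⟩, rfl⟩
  have hnf : ∀ d, Q.face (Q.next d) = Q.face d := fun d => Quotient.sound
    (Equiv.Perm.sameCycle_apply_left.2 (Equiv.Perm.SameCycle.refl Q.next d))
  have hstep : ∀ d : Q.Angle, d.fst ∈ black → (Q.next d).fst ∉ black := fun d hd => by
    rw [Q.next_fst]; exact (hB d).1 hd
  have hstep' : ∀ d : Q.Angle, d.fst ∉ black → (Q.next d).fst ∈ black := fun d hd => by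
    rw [Q.next_fst]
    by_contra h
    exact hd ((hB d).2 h)
  have hblack : ∀ f : Q.Face, ∃ d : Q.Angle, d.fst ∈ black ∧ Q.face d = f := by
    intro f
    obtain ⟨d, rfl⟩ := Quotient.exists_rep f
    by_cases hd : d.fst ∈ black
    · exact ⟨d, hd, rfl⟩
    · exact ⟨Q.next d, hstep' d hd, hnf d⟩
  -- A face has four corners of alternating colors, so its black ones are `d` and the corner
  -- opposite to it.
  have hface : ∀ d e : Q.Angle, d.fst ∈ black → e.fst ∈ black → Q.face d = Q.face e →
      e = d ∨ e = Q.next (Q.next d) := by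
    intro d e hd he hde
    have hs : Q.next.SameCycle d e := Quotient.exact hde
    obtain ⟨k, rfl⟩ := hs.exists_nat_pow_eq
    clear hs hde
    have hall : (Q.next ^ k) d = d ∨ (Q.next ^ k) d = Q.next d ∨
        (Q.next ^ k) d = Q.next (Q.next d) ∨ (Q.next ^ k) d = Q.next (Q.next (Q.next d)) := by
      clear he
      induction k with
      | zero => exact Or.inl rfl
      | succ k ih =>
        rw [pow_succ', Equiv.Perm.mul_apply]
        rcases ih with h | h | h | h <;> rw [h]
        · exact Or.inr (Or.inl rfl)
        · exact Or.inr (Or.inr (Or.inl rfl))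
        · exact Or.inr (Or.inr (Or.inr rfl))
        · exact Or.inl (h4 d)
    rcases hall with h | h | h | h <;> rw [h] at he ⊢
    · exact Or.inl rfl
    · exact absurd he (hstep d hd)
    · exact Or.inr rfl
    · exact absurd he (hstep _ (hstep' _ (hstep d hd)))
  obtain ⟨o, ho, hof⟩ := hblack Q.outerFace
  have houter : black ∩ Q.outerVertices = {o.fst, Q.opp o} := by
    ext v
    constructor
    · rintro ⟨hv, a, rfl, ha⟩
      rcases hface o a ho hv (hof.trans ha.symm) with rfl | rfl
      · exact Or.inl rfl
      · exact Or.inr rfl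
    · rintro (rfl | rfl)
      · exact ⟨ho, o, rfl, hof⟩
      · exact ⟨hstep' _ (hstep o ho), Q.next (Q.next o), rfl,
          (hnf _).trans ((hnf _).trans hof)⟩
  have htwo : (black ∩ Q.outerVertices).ncard = 2 := by
    rw [houter, Set.ncard_pair (hopp o).symm]
  refine ⟨htwo, fun s₀ hs₀ s₁ hs₁ hne => ?_⟩
  obtain ⟨h, hdiff, hmin, hmax, hmid⟩ :=
    PlaneGraph.exists_numbering h4 hopp hB hdart hs₀.1 hs₁.1 hne
  have hedge := PlaneGraph.numberingLabel_edge_rule h4 hB hdiff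
  have hoppB : ∀ d : Q.Angle, d.fst ∈ black → Q.opp d ∈ black := fun d hd =>
    hstep' _ (hstep d hd)
  refine ⟨Q.numberingLabel black h, hne, ?_, ?_, ?_, ?_, hedge, ?_, ?_⟩
  · refine (Set.eq_of_subset_of_ncard_le (Set.insert_subset hs₀ (Set.singleton_subset_iff.2 hs₁))
      ?_).symm
    rw [htwo, Set.ncard_pair hne]
  · rintro a rfl
    rw [PlaneGraph.numberingLabel_of_mem hs₀.1, if_pos]
    exact hmin _ (hoppB a hs₀.1) (hopp a)
  · rintro a rfl
    rw [PlaneGraph.numberingLabel_of_mem hs₁.1, if_neg]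
    exact (hmax _ (hoppB a hs₁.1) (hopp a)).not_gt
  · intro v hv₀ hv₁
    refine PlaneGraph.vertex_rule_of_edge_rule (by omega) hE hedge hne ?_ hv₀ hv₁
    intro v hv₀ hv₁
    by_cases hv : v ∈ black
    · obtain ⟨⟨d, rfl, hd⟩, ⟨e, he, he'⟩⟩ := hmid v hv hv₀ hv₁
      refine ⟨⟨e, he, ?_⟩, ⟨d, rfl, ?_⟩⟩
      · rw [PlaneGraph.numberingLabel_of_mem (he ▸ hv), if_pos (he ▸ he')]
      · rw [PlaneGraph.numberingLabel_of_mem hv, if_neg hd.not_gt]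
    · exact PlaneGraph.exists_numberingLabel_of_notMem hB hdiff hdart hv
  · intro f
    obtain ⟨d, hd, hdf⟩ := hblack f
    -- The pattern 0011 starts at the black corner with the smaller number.
    rcases lt_or_gt_of_ne (hdiff d hd) with hlt | hlt
    · exact ⟨d, hdf, h4 d, PlaneGraph.numberingLabel_face h4 hB hdiff hd hlt⟩
    · refine ⟨Q.next (Q.next d), (hnf _).trans ((hnf _).trans hdf), h4 _,
        PlaneGraph.numberingLabel_face h4 hB hdiff (hstep' _ (hstep d hd)) ?_⟩
      have : Q.opp (Q.next (Q.next d)) = d.fst := by rw [PlaneGraph.opp, h4]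
      rw [this]
      exact hlt
  · rintro a ha rfl
    exact PlaneGraph.numberingLabel_face h4 hB hdiff hs₀.1 (hmin _ (hoppB a hs₀.1) (hopp a))
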